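/- **Conventions.** A represented space is a set $X$ with a surjective partial map $\delta_X:\subseteq\mathbb N^{\mathbb N}\to X$; a $p$ with $\delta_X(p)=x$ is a name of $x$. Here $\mathbb N$ is represented by $p\mapsto p(0)$, subsets of a represented space by the restricted representation, and $X^{\mathbb N}$ by $\langle p_0,p_1,\dots\rangle\mapsto(\delta_X(p_i))_i$. For a partial multi-valued map $f:\subseteq X\rightrightarrows Y$ between represented spaces, a partial map $F:\subseteq\mathbb N^{\mathbb N}\to\mathbb N^{\mathbb N}$ is a realizer of $f$, written $F\vdash f$, if $F(p)$ is defined and is a name of an element of $f(x)$ for every name $p$ of every $x\in\mathrm{dom}(f)$. The map $f$ is computable if it has a computable realizer. Strong Weihrauch reducibility $f\le_{\mathrm{sW}}g$ means that there are computable $H,K:\subseteq\mathbb N^{\mathbb N}\to\mathbb N^{\mathbb N}$ with $HGK\vdash f$ for all $G\vdash g$; and $f\equiv_{\mathrm{sW}}g$ means $f\le_{\mathrm{sW}}g$ and $g\le_{\mathrm{sW}}f$. A computable Polish space $(X,d,\alpha)$ is a complete metric space $(X,d)$ with a dense sequence $\alpha:\mathbb N\to X$ such that $(n,m)\mapsto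 d(\alpha(n),\alpha(m))$ is a computable double sequence of reals. It is represented by its Cauchy representation: $p$ is a name of $x$ if $\alpha(p(n))\to x$ and $d(\alpha(p(n)),\alpha(p(k)))<2^{-k}$ for all $n\ge k$. Let $\mathcal A_+(X)$ be the set of closed subsets of $X$, where a name of $A$ is a name of a sequence in the coproduct $X\sqcup\{\infty\}$ whose members in $X$ have closure $A$ in $X$. The space $X$ is perfect if it has no isolated points. Define - $\mathsf{BCT}_2:\subseteq\mathcal A_+(X)^{\mathbb N}\rightrightarrows X$, $(A_i)_i\mapsto X\setminus\bigcup_i A_i$, with domain $\{(A_i)_i:(\forall i)\ A_i^\circ=\emptyset\}$; - $\mathsf{BCT}_3:\subseteq\mathcal A_+(X)^{\mathbb N}\rightrightarrows\mathbb N$, $(A_i)_i\mapsto\{i:A_i^\circ\neq\emptyset\}$, with domain $\{(A_i)_i:X=\bigcup_i A_i\}$; - $\mathsf{CL}_{\mathbb N}:\subseteq\mathbb N^{\mathbb N}\rightrightarrows\mathbb N$, mapping each sequence of natural numbers that has a cluster point to the set of its cluster points; - $\mathrm{id}_{\{0\}}$ and $\mathrm{id}_{\mathbb N}$, the identities on the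 represented spaces $\{0\}\subseteq\mathbb N$ and $\mathbb N$. **Statement.** Let $X$ be a computable Polish space. Then $X$ is perfect if and only if $\mathsf{BCT}_3$ is not computable, and in that case $\mathsf{BCT}_3\equiv_{\mathrm{sW}}\mathsf{CL}_{\mathbb N}$. If $X$ is not perfect, then $\mathsf{BCT}_2\equiv_{\mathrm{sW}}\mathrm{id}_{\{0\}}$ and $\mathsf{BCT}_3\equiv_{\mathrm{sW}}\mathrm{id}_{\mathbb N}$. -/

import Mathlib

open Filter Topology

namespace Weihrauch

universe u v w z

/-! ### Computability on Baire space -/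

/-- The finite prefix `p(0), …, p(n-1)` of a sequence. -/
def pre (p : ℕ → ℕ) (n : ℕ) : List ℕ := (List.range n).map p

/-- Computable partial functions `F : ⊆ ℕ^ℕ → ℕ^ℕ` (type-2 computability): there is a computable
function on finite words, monotone for the prefix order, such that for every `p` in the domain of
`F` the words obtained from longer and longer prefixes of `p` are prefixes of `F p` of unbounded
length. As usual in the definition of realizers and reductions, `F` may be a restriction of the
function that the word function determines. -/
def ComputablePFun (F : (ℕ → ℕ) →. (ℕ → ℕ)) : Prop :=
  ∃ φ : List ℕ → List ℕ, Computable φ ∧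
    (∀ s t : List ℕ, s <+: t → φ s <+: φ t) ∧
    ∀ p : ℕ → ℕ, ∀ q ∈ F p,
      (∀ n, ∃ m, φ (pre p n) = pre q m) ∧ (∀ m, ∃ n, m ≤ (φ (pre p n)).length)

/-! ### Represented spaces -/

/-- A represented space: a set with a surjective partial map `δ : ⊆ ℕ^ℕ → X`, given by its graph
`IsName p x` (meaning `δ p = x`). -/
structure RepSpace where
  carrier : Type u
  IsName : (ℕ → ℕ) → carrier → Prop
  unique : ∀ p x y, IsName p x → IsName p y → x = y
  surj : ∀ x, ∃ p, IsName p x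

instance : CoeSort RepSpace.{u} (Type u) := ⟨RepSpace.carrier⟩

/-- The natural numbers, `δ(p) = p(0)`. -/
abbrev natSpace : RepSpace.{0} where
  carrier := ℕ
  IsName p n := p 0 = n
  unique _ _ _ h h' := h.symm.trans h'
  surj n := ⟨fun _ => n, rfl⟩

/-- A subset of a represented space, with the restricted representation. -/
abbrev subSpace (X : RepSpace.{u}) (S : Set X) : RepSpace.{u} where
  carrier := S
  IsName p x := X.IsName p x.1
  unique p _ _ h h' := Subtype.ext (X.unique p _ _ h h')
  surj x := X.surj x.1

/-- The space `X^ℕ` of sequences: `⟨p₀, p₁, …⟩` is a name of `(x₀, x₁, …)` if each `p_i` is a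
name of `x_i`, where `⟨p₀, p₁, …⟩⟨i, j⟩ = p_i(j)`. -/
abbrev seqSpace (X : RepSpace.{u}) : RepSpace.{u} where
  carrier := ℕ → X
  IsName p x := ∀ i, X.IsName (fun j => p (Nat.pair i j)) (x i)
  unique _ x y h h' := funext fun i => X.unique _ (x i) (y i) (h i) (h' i)
  surj x := by
    choose q hq using fun i => X.surj (x i)
    refine ⟨fun m => q m.unpair.1 m.unpair.2, fun i => ?_⟩
    simpa using hq i

/-- The coproduct `X ⊔ {∞}`: a name of a point of `X` (here `some x`) is a `0` followed by a name
of `x`; every sequence that starts with another number is a name of `∞` (here `none`). -/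
abbrev addInfty (X : RepSpace.{u}) : RepSpace.{u} where
  carrier := Option X
  IsName p y := (y = none ∧ p 0 ≠ 0) ∨
    ∃ x : X, y = some x ∧ p 0 = 0 ∧ X.IsName (fun n => p (n + 1)) x
  unique p y y' h h' := by
    rcases h with ⟨rfl, h0⟩ | ⟨x, rfl, h0, h1⟩ <;> rcases h' with ⟨rfl, h0'⟩ | ⟨x', rfl, h0', h1'⟩
    · rfl
    · exact absurd h0' h0
    · exact absurd h0 h0'
    · rw [X.unique _ _ _ h1 h1']
  surj y := by
    cases y with
    | none => exact ⟨fun _ => 1, Or.inl ⟨rfl, one_ne_zero⟩⟩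
    | some x =>
      obtain ⟨p, hp⟩ := X.surj x
      exact ⟨fun n => Nat.casesOn n 0 p, Or.inr ⟨x, rfl, rfl, hp⟩⟩

/-! ### Computable metric spaces -/

/-- The data making a metric space a computable metric space `(X, d, α)`: a dense sequence `α` such
that `(n, m) ↦ d(α n, α m)` is a computable double sequence of real numbers, i.e. rational
approximations `a / (b + 1)` of precision `2⁻ᵏ` can be computed from `n, m, k`. -/
structure ComputableMetric (X : Type u) [MetricSpace X] where
  α : ℕ → X
  dense : DenseRange α
  computable_dist : ∃ a b : ℕ × ℕ × ℕ → ℕ, Computable a ∧ Computable b ∧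
    ∀ n m k, |dist (α n) (α m) - (a (n, m, k) : ℝ) / ((b (n, m, k) : ℝ) + 1)| ≤ (1 / 2 : ℝ) ^ k

variable {X : Type u} [MetricSpace X]

/-- `X` with its Cauchy representation: names are the rapidly converging sequences of indices. -/
abbrev cauchySpace (𝒳 : ComputableMetric X) : RepSpace.{u} where
  carrier := X
  IsName p x := (∀ k n, k ≤ n → dist (𝒳.α (p n)) (𝒳.α (p k)) < (1 / 2 : ℝ) ^ k) ∧
    Tendsto (fun n => 𝒳.α (p n)) atTop (𝓝 x)
  unique _ _ _ h h' := tendsto_nhds_unique h.2 h'.2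
  surj x := by
    have hpos : ∀ n : ℕ, (0 : ℝ) < (1 / 2 : ℝ) ^ (n + 1) := fun n => by positivity
    choose p hp using fun n => 𝒳.dense.exists_dist_lt x (hpos n)
    refine ⟨p, fun k n hkn => ?_, ?_⟩
    · have h1 : (1 / 2 : ℝ) ^ (n + 1) ≤ (1 / 2 : ℝ) ^ (k + 1) :=
        pow_le_pow_of_le_one (by norm_num) (by norm_num) (by omega)
      have h2 := dist_triangle_left (𝒳.α (p n)) (𝒳.α (p k)) x
      have h3 : (1 / 2 : ℝ) ^ (k + 1) = (1 / 2 : ℝ) ^ k / 2 := by ring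
      linarith [hp n, hp k]
    · have ht : Tendsto (fun n : ℕ => (1 / 2 : ℝ) ^ (n + 1)) atTop (𝓝 0) :=
        (tendsto_pow_atTop_nhds_zero_of_lt_one (by norm_num) (by norm_num)).comp
          (tendsto_add_atTop_nat 1)
      refine tendsto_iff_dist_tendsto_zero.2
        (squeeze_zero (fun _ => dist_nonneg) (fun n => ?_) ht)
      rw [dist_comm]
      exact (hp n).le

/-- The hyperspace `𝒜₊(X)` of closed subsets with positive information: a name of `A` is a name of
a sequence in `X ⊔ {∞}` whose members in `X` form a dense subset of `A`. -/
abbrev closedPos (𝒳 : ComputableMetric X) : RepSpace.{u} where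
  carrier := TopologicalSpace.Closeds X
  IsName p A := ∃ y : ℕ → Option X, (seqSpace (addInfty (cauchySpace 𝒳))).IsName p y ∧
    closure {x : X | ∃ n, y n = some x} = (A : Set X)
  unique p A B h h' := by
    obtain ⟨y, hy, hA⟩ := h
    obtain ⟨y', hy', hB⟩ := h'
    have e : y = y' := (seqSpace (addInfty (cauchySpace 𝒳))).unique p y y' hy hy'
    subst e
    exact TopologicalSpace.Closeds.ext (hA.symm.trans hB)
  surj A := by
    have hsep : TopologicalSpace.SeparableSpace X :=
      ⟨⟨Set.range 𝒳.α, Set.countable_range _, 𝒳.dense⟩⟩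
    obtain ⟨t, htA, htc, hAt⟩ :=
      (TopologicalSpace.IsSeparable.of_separableSpace (A : Set X)).exists_countable_dense_subset
    have hcl : closure t = (A : Set X) :=
      Set.Subset.antisymm (closure_minimal htA A.isClosed) hAt
    obtain ⟨y, hy⟩ : ∃ y : ℕ → Option X, {x : X | ∃ n, y n = some x} = t := by
      rcases t.eq_empty_or_nonempty with rfl | hne
      · exact ⟨fun _ => none, by simp⟩
      · obtain ⟨f, rfl⟩ := htc.exists_eq_range hne
        exact ⟨fun n => some (f n), by ext; simp⟩
    obtain ⟨p, hp⟩ := (seqSpace (addInfty (cauchySpace 𝒳))).surj y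
    exact ⟨p, y, hp, by rw [hy, hcl]⟩

/-! ### Problems, realizers and strong Weihrauch reducibility -/

/-- A partial multi-valued function `f : ⊆ X ⇉ Y` on represented spaces. Only the values at points
of the domain matter. -/
structure MultiFun (X : RepSpace.{u}) (Y : RepSpace.{v}) where
  dom : Set X
  val : X → Set Y
  nonempty : ∀ x ∈ dom, (val x).Nonempty

/-- `F ⊢ f`: for every name `p` of a point `x ∈ dom f`, `F p` is defined and is a name of some
element of `f x`. -/
def Realizes {X : RepSpace.{u}} {Y : RepSpace.{v}} (F : (ℕ → ℕ) →. (ℕ → ℕ)) (f : MultiFun X Y) :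
    Prop :=
  ∀ p x, X.IsName p x → x ∈ f.dom → ∃ q ∈ F p, ∃ y, Y.IsName q y ∧ y ∈ f.val x

/-- A problem is computable if it has a computable realizer. -/
def MultiFun.IsComputable {X : RepSpace.{u}} {Y : RepSpace.{v}} (f : MultiFun X Y) : Prop :=
  ∃ F, ComputablePFun F ∧ Realizes F f

/-- Strong Weihrauch reducibility: there are computable `H, K` such that `H ∘ G ∘ K ⊢ f` for all
`G ⊢ g`. -/
def SWReducible {X : RepSpace.{u}} {Y : RepSpace.{v}} {Z : RepSpace.{w}} {W : RepSpace.{z}}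
    (f : MultiFun X Y) (g : MultiFun Z W) : Prop :=
  ∃ H K, ComputablePFun H ∧ ComputablePFun K ∧
    ∀ G, Realizes G g → Realizes (H.comp (G.comp K)) f

/-- Strong Weihrauch equivalence. -/
def SWEquiv {X : RepSpace.{u}} {Y : RepSpace.{v}} {Z : RepSpace.{w}} {W : RepSpace.{z}}
    (f : MultiFun X Y) (g : MultiFun Z W) : Prop :=
  SWReducible f g ∧ SWReducible g f

infix:50 " ≤sW " => SWReducible
infix:50 " ≡sW " => SWEquiv

/-! ### The problems -/

/-- The identity `id_X : X → X`. -/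
def idProblem (X : RepSpace.{u}) : MultiFun X X where
  dom := Set.univ
  val x := {x}
  nonempty x _ := ⟨x, rfl⟩

/-- The identity on the subspace `{0}` of `ℕ`. -/
def idZero : MultiFun (subSpace natSpace ({0} : Set ℕ)) (subSpace natSpace ({0} : Set ℕ)) :=
  idProblem _

/-- The identity on `ℕ`. -/
def idNat : MultiFun natSpace natSpace := idProblem natSpace

/-- The cluster point problem of `ℕ` (discrete topology): given a sequence that has a cluster
point, find one. -/
def CLNat : MultiFun (seqSpace natSpace) natSpace where
  dom := {x : ℕ → ℕ | ∃ n : ℕ, MapClusterPt n atTop x}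
  val := fun x : ℕ → ℕ => {n : ℕ | MapClusterPt n atTop x}
  nonempty _ h := h

/-- `BCT₂`: given closed sets `A_i` with empty interior by positive information, find a point
outside of all of them. -/
def BCT₂ [CompleteSpace X] (𝒳 : ComputableMetric X) :
    MultiFun (seqSpace (closedPos 𝒳)) (cauchySpace 𝒳) where
  dom := {A : ℕ → TopologicalSpace.Closeds X | ∀ i, interior (A i : Set X) = ∅}
  val := fun A : ℕ → TopologicalSpace.Closeds X => (⋃ i, (A i : Set X))ᶜ
  nonempty A hA := by
    have : Nonempty X := ⟨𝒳.α 0⟩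
    have h := dense_iInter_of_isOpen (f := fun i => ((A i).carrier)ᶜ)
      (fun i => (A i).isClosed.isOpen_compl)
      (fun i => interior_eq_empty_iff_dense_compl.1 (hA i))
    obtain ⟨x, hx⟩ := h.nonempty
    exact ⟨x, fun h => by
      obtain ⟨i, hi⟩ := Set.mem_iUnion.1 h
      exact Set.mem_iInter.1 hx i hi⟩

/-- `BCT₃`: given closed sets `A_i` that cover `X` by positive information, find an index `i` such
that `A_i` has non-empty interior. -/
def BCT₃ [CompleteSpace X] (𝒳 : ComputableMetric X) :
    MultiFun (seqSpace (closedPos 𝒳)) natSpace where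
  dom := {A : ℕ → TopologicalSpace.Closeds X | ⋃ i, (A i : Set X) = Set.univ}
  val := fun A : ℕ → TopologicalSpace.Closeds X => {i : ℕ | (interior (A i : Set X)).Nonempty}
  nonempty := fun (A : ℕ → TopologicalSpace.Closeds X) hA => by
    have : Nonempty X := ⟨𝒳.α 0⟩
    exact nonempty_interior_of_iUnion_of_closed
      (f := fun i => (A i : Set X)) (fun i => (A i).isClosed) hA

end Weihrauch

open Weihrauch

namespace Weihrauch

universe u v w z

/-! ### Prefixes -/

/-! The point is the quantifier complexity of "`A i` has non-empty interior". Positive information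
on `A i` semidecides that a given ball, up to a constant factor in the radius, meets `A i`. By
density of `α` and closedness, `A i` has non-empty interior iff some coded ball `e` satisfies `∀ n,
∃ m` of a test that is decidable in the name (`interior_nonempty_of_ballTest`,
`exists_ballTest_of_interior_nonempty`). Finding such an `e` is a cluster point problem: emit a
label for `e` whenever witnesses for longer and longer initial segments of the `n` are found
(`frequently_emission_iff`). Baire's theorem supplies the cluster point. This bound needs no
perfectness.

Conversely, let each occurrence of `i` in a sequence put more of the dense sequence into `A i`. An
infinitely frequent value gets `A i = X`; any other gets a finite set, which in a perfect space has
empty interior. So `CLNat` reduces to `BCT₃`, and `CLNat` is discontinuous, hence not computable.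

An isolated point lies in the dense sequence, so it is computable. It avoids every closed set with
empty interior and so solves `BCT₂` outright; any `A i` containing it solves `BCT₃`, and such an `i`
is found by search. The remaining reductions use the sets `∅` and `X` only. -/

@[simp] lemma length_pre (p : ℕ → ℕ) (n : ℕ) : (pre p n).length = n := by simp [pre]

lemma getElem?_pre {p : ℕ → ℕ} {n i : ℕ} (h : i < n) : (pre p n)[i]? = some (p i) := by
  simp [pre, h]

lemma pre_prefix_pre (p : ℕ → ℕ) {m n : ℕ} (h : m ≤ n) : pre p m <+: pre p n := by
  obtain ⟨k, rfl⟩ := Nat.exists_eq_add_of_le h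
  simp [pre, List.range_add]

lemma getElem?_of_prefix {s t : List ℕ} (h : s <+: t) {i a : ℕ} (hi : s[i]? = some a) :
    t[i]? = some a := by
  obtain ⟨r, rfl⟩ := h
  obtain ⟨hl, -⟩ := List.getElem?_eq_some_iff.1 hi
  rw [List.getElem?_append_left hl, hi]

lemma prefix_of_forall_getElem? {s t : List ℕ}
    (h : ∀ i a : ℕ, s[i]? = some a → t[i]? = some a) :
    s <+: t := by
  rw [List.prefix_iff_getElem?]
  intro i hi
  exact h i _ (List.getElem?_eq_getElem hi)

lemma eq_pre_length {s : List ℕ} {q : ℕ → ℕ} (h : ∀ i a : ℕ, s[i]? = some a → a = q i) :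
    s = pre q s.length := by
  apply List.ext_getElem?
  intro i
  by_cases hi : i < s.length
  · rw [getElem?_pre hi, List.getElem?_eq_getElem hi, h i _ (List.getElem?_eq_getElem hi)]
  · rw [List.getElem?_eq_none (by omega), List.getElem?_eq_none (by simp; omega)]

/-! ### Functionals given by monotone word functions -/

/-- A partial information function on words which is stable under extending the word. -/
def WordMonotone {α β : Type*} (g : List ℕ → α → Option β) : Prop :=
  ∀ s t a b, s <+: t → g s a = some b → g t a = some b

/-- The longest list of values `g s 0, g s 1, …` which are all defined, of length at most `n`. -/
def definedValues (g : List ℕ → ℕ → Option ℕ) (s : List ℕ) (n : ℕ) : List ℕ :=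
  Nat.rec [] (fun _ l => Option.casesOn (g s l.length) l fun v => l ++ [v]) n

lemma definedValues_spec (g : List ℕ → ℕ → Option ℕ) (s : List ℕ) (n : ℕ) :
    (∀ i v, (definedValues g s n)[i]? = some v → g s i = some v) ∧
      (definedValues g s n).length ≤ n ∧
      ((definedValues g s n).length < n → g s (definedValues g s n).length = none) := by
  induction n with
  | zero => simp [definedValues]
  | succ n ih =>
    obtain ⟨h1, h2, h3⟩ := ih
    have e : definedValues g s (n + 1) = Option.casesOn (g s (definedValues g s n).length)
      (definedValues g s n) fun v => definedValues g s n ++ [v] := rfl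
    rcases hv : g s (definedValues g s n).length with _ | v
    · rw [hv] at e
      simp only at e
      rw [e]
      exact ⟨h1, by omega, fun _ => hv⟩
    · rw [hv] at e
      simp only at e
      have hlen : (definedValues g s n).length = n := by
        by_contra hne
        rw [h3 (by omega)] at hv
        cases hv
      rw [e]
      refine ⟨fun i w hw => ?_, by simp [hlen], by simp [hlen]⟩
      rcases lt_or_ge i (definedValues g s n).length with hi | hi
      · rw [List.getElem?_append_left hi] at hw
        exact h1 i w hw
      · rw [List.getElem?_append_right hi] at hw
        rcases Nat.eq_zero_or_pos (i - (definedValues g s n).length) with h0 | h0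
        · rw [h0] at hw
          simp only [List.getElem?_cons_zero, Option.some.injEq] at hw
          rw [← hw, ← hv]
          congr 1
          omega
        · rw [List.getElem?_eq_none (by simp; omega)] at hw
          cases hw

/-- Information persists when the word grows, so both lists record values of `g t`, and only their
lengths have to be compared. -/
lemma definedValues_prefix {g : List ℕ → ℕ → Option ℕ} (hg : WordMonotone g) {s t : List ℕ}
    (h : s <+: t) {m n : ℕ} (hmn : m ≤ n) : definedValues g s m <+: definedValues g t n := by
  obtain ⟨h1, h2, -⟩ := definedValues_spec g s m
  obtain ⟨h1', -, h3'⟩ := definedValues_spec g t n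
  have hle : (definedValues g s m).length ≤ (definedValues g t n).length := by
    by_contra hlt
    push Not at hlt
    have := hg _ _ _ _ h (h1 _ _ (List.getElem?_eq_getElem hlt))
    rw [h3' (by omega)] at this
    cases this
  refine prefix_of_forall_getElem? fun i a hi => ?_
  obtain ⟨hl, -⟩ := List.getElem?_eq_some_iff.1 hi
  have hit : i < (definedValues g t n).length := by omega
  have e1 := hg _ _ _ _ h (h1 i a hi)
  have e2 := h1' _ _ (List.getElem?_eq_getElem hit)
  rw [List.getElem?_eq_getElem hit, ← e1, ← e2]

lemma WordMonotone.eq_of_pre {α β : Type*} {g : List ℕ → α → Option β} (hg : WordMonotone g)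
    {p : ℕ → ℕ} {m n : ℕ} {a : α} {b c : β} (hb : g (pre p m) a = some b)
    (hc : g (pre p n) a = some c) : b = c := by
  have h1 := hg _ _ _ _ (pre_prefix_pre p (le_max_left m n)) hb
  have h2 := hg _ _ _ _ (pre_prefix_pre p (le_max_right m n)) hc
  exact Option.some.inj (h1.symm.trans h2)

/-- Passes from digit-by-digit computation to a monotone word function: output the longest initial
block of digits already determined by the word, capped at the length of the word so that the
recursion is bounded. -/
lemma computablePFun_of_word {F : (ℕ → ℕ) →. (ℕ → ℕ)} {g : List ℕ → ℕ → Option ℕ}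
    (hgc : Computable₂ g) (hg : WordMonotone g)
    (hF : ∀ p, ∀ q ∈ F p, ∀ i, ∃ n, g (pre p n) i = some (q i)) : ComputablePFun F := by
  refine ⟨fun s => definedValues g s s.length, ?_, fun s t h =>
    definedValues_prefix hg h h.length_le, fun p q hq => ?_⟩
  · refine Computable.nat_rec (f := fun s : List ℕ => s.length) (g := fun _ => ([] : List ℕ))
      (h := fun s y => Option.casesOn (g s y.2.length) y.2 fun v => y.2 ++ [v])
      Computable.list_length (Computable.const []) ?_
    have hl : Computable fun x : List ℕ × ℕ × List ℕ => x.2.2 :=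
      Computable.snd.comp Computable.snd
    exact Computable.option_casesOn
      (hgc.comp Computable.fst (Computable.list_length.comp hl)) hl
      (Computable.list_concat.comp (hl.comp Computable.fst) Computable.snd)
  · have key : ∀ n i v, g (pre p n) i = some v → v = q i := fun n i v hv => by
      obtain ⟨m, hm⟩ := hF p q hq i
      exact hg.eq_of_pre hv hm
    constructor
    · intro n
      exact ⟨_, eq_pre_length fun i a hi =>
        key n i a ((definedValues_spec g (pre p n) _).1 i a hi)⟩
    · intro m
      choose N hN using hF p q hq
      -- The prefix must have length at least `m` because of the cap, and must determine each of the
      -- first `m` digits.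
      refine ⟨max m ((Finset.range m).sup N), ?_⟩
      obtain ⟨-, -, h3⟩ := definedValues_spec g (pre p (max m ((Finset.range m).sup N)))
        (pre p (max m ((Finset.range m).sup N))).length
      by_contra! hlt
      have hnone := h3 (by rw [length_pre] at hlt ⊢; omega)
      have hsome := hg _ _ _ _ (pre_prefix_pre p ((Finset.le_sup (Finset.mem_range.2 hlt)).trans
        (le_max_right m _))) (hN _)
      rw [hnone] at hsome
      cases hsome

/-! ### Total functions which are uniformly computable in an oracle -/

section

variable {α β γ : Type*} [Primcodable α] [Primcodable β] [Primcodable γ]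

/-- `f p a` can be computed from `a` with `p` as an oracle. -/
def OracleComputable (f : (ℕ → ℕ) → α → β) : Prop :=
  ∃ g : List ℕ → α → Option β, Computable₂ g ∧ WordMonotone g ∧
    ∀ p a, ∃ n, g (pre p n) a = some (f p a)

namespace OracleComputable

lemma of_computable {f : α → β} (hf : Computable f) :
    OracleComputable fun (_ : ℕ → ℕ) a => f a :=
  ⟨fun _ a => some (f a), Computable.option_some.comp (hf.comp Computable.snd),
    fun _ _ _ _ _ h => h, fun _ _ => ⟨0, rfl⟩⟩

lemma query : OracleComputable fun (p : ℕ → ℕ) n => p n :=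
  ⟨fun s n => s[n]?, Computable.list_getElem?, fun _ _ _ _ h ha => getElem?_of_prefix h ha,
    fun _ n => ⟨n + 1, getElem?_pre (Nat.lt_succ_self n)⟩⟩

lemma comp {f : (ℕ → ℕ) → β → γ} {h : (ℕ → ℕ) → α → β} (hf : OracleComputable f)
    (hh : OracleComputable h) : OracleComputable fun p a => f p (h p a) := by
  obtain ⟨g, gc, gm, gf⟩ := hf
  obtain ⟨k, kc, km, kh⟩ := hh
  refine ⟨fun s a => (k s a).bind (g s), ?_, ?_, ?_⟩
  · exact Computable.option_bind kc
      (gc.comp (Computable.fst.comp Computable.fst) Computable.snd)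
  · intro s t a b hst hb
    obtain ⟨v, hv, hb⟩ := Option.bind_eq_some_iff.1 hb
    exact Option.bind_eq_some_iff.2 ⟨v, km _ _ _ _ hst hv, gm _ _ _ _ hst hb⟩
  · intro p a
    obtain ⟨m, hm⟩ := kh p a
    obtain ⟨n, hn⟩ := gf p (h p a)
    exact ⟨max m n, Option.bind_eq_some_iff.2
      ⟨_, km _ _ _ _ (pre_prefix_pre p (le_max_left m n)) hm,
        gm _ _ _ _ (pre_prefix_pre p (le_max_right m n)) hn⟩⟩

lemma pair {f : (ℕ → ℕ) → α → β} {h : (ℕ → ℕ) → α → γ} (hf : OracleComputable f)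
    (hh : OracleComputable h) : OracleComputable fun p a => (f p a, h p a) := by
  obtain ⟨g, gc, gm, gf⟩ := hf
  obtain ⟨k, kc, km, kh⟩ := hh
  refine ⟨fun s a => (g s a).bind fun b => (k s a).bind fun c => some (b, c), ?_, ?_, ?_⟩
  · refine Computable.option_bind gc ?_
    refine Computable.option_bind (kc.comp (Computable.fst.comp Computable.fst)
      (Computable.snd.comp Computable.fst)) ?_
    exact Computable.option_some.comp
      ((Computable.snd.comp Computable.fst).pair Computable.snd)
  · intro s t a b hst hb
    obtain ⟨v, hv, hb⟩ := Option.bind_eq_some_iff.1 hb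
    obtain ⟨w, hw, hb⟩ := Option.bind_eq_some_iff.1 hb
    exact Option.bind_eq_some_iff.2 ⟨v, gm _ _ _ _ hst hv,
      Option.bind_eq_some_iff.2 ⟨w, km _ _ _ _ hst hw, hb⟩⟩
  · intro p a
    obtain ⟨m, hm⟩ := kh p a
    obtain ⟨n, hn⟩ := gf p a
    exact ⟨max m n, Option.bind_eq_some_iff.2
      ⟨_, gm _ _ _ _ (pre_prefix_pre p (le_max_right m n)) hn, Option.bind_eq_some_iff.2
        ⟨_, km _ _ _ _ (pre_prefix_pre p (le_max_left m n)) hm, rfl⟩⟩⟩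

lemma map {c : β → γ} (hc : Computable c) {f : (ℕ → ℕ) → α → β} (hf : OracleComputable f) :
    OracleComputable fun p a => c (f p a) :=
  (of_computable hc).comp hf

lemma map₂ {δ : Type*} [Primcodable δ] {c : β → γ → δ} (hc : Computable₂ c)
    {f : (ℕ → ℕ) → α → β} {h : (ℕ → ℕ) → α → γ} (hf : OracleComputable f)
    (hh : OracleComputable h) : OracleComputable fun p a => c (f p a) (h p a) :=
  map (c := fun x : β × γ => c x.1 x.2) hc (hf.pair hh)

/-- On words the recursion runs through `Option` and is undefined as soon as one stage is
undetermined. Only finitely many stages occur, so some finite prefix of the oracle determines them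
all. -/
lemma natRec {n : (ℕ → ℕ) → α → ℕ} {z : (ℕ → ℕ) → α → β} {f : (ℕ → ℕ) → α × ℕ × β → β}
    (hn : OracleComputable n) (hz : OracleComputable z) (hf : OracleComputable f) :
    OracleComputable fun p a => (Nat.rec (z p a) (fun k b => f p (a, k, b)) (n p a) : β) := by
  have main : OracleComputable fun p (x : α × ℕ) =>
      (Nat.rec (z p x.1) (fun k b => f p (x.1, k, b)) x.2 : β) := by
    obtain ⟨g, gc, gm, gf⟩ := hf
    obtain ⟨k, kc, km, kh⟩ := hz
    have hmono : WordMonotone fun s (x : α × ℕ) =>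
        (Nat.rec (k s x.1) (fun j o => o.bind fun b => g s (x.1, j, b)) x.2 : Option β) := by
      rintro s t ⟨a, j⟩ b hst hb
      induction j generalizing b with
      | zero => exact km _ _ _ _ hst hb
      | succ j ih =>
        obtain ⟨v, hv, hb⟩ := Option.bind_eq_some_iff.1 hb
        exact Option.bind_eq_some_iff.2 ⟨v, ih _ hv, gm _ _ _ _ hst hb⟩
    refine ⟨fun s x => Nat.rec (k s x.1) (fun j o => o.bind fun b => g s (x.1, j, b)) x.2,
      ?_, hmono, ?_⟩
    · refine Computable.nat_rec (f := fun x : List ℕ × α × ℕ => x.2.2)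
        (h := fun x y => y.2.bind fun b => g x.1 (x.2.1, y.1, b))
        (Computable.snd.comp Computable.snd) (kc.comp Computable.fst (Computable.fst.comp Computable.snd)) ?_
      refine Computable.option_bind (Computable.snd.comp Computable.snd) ?_
      refine gc.comp (Computable.fst.comp (Computable.fst.comp Computable.fst)) ?_
      exact (Computable.fst.comp (Computable.snd.comp (Computable.fst.comp Computable.fst))).pair
        ((Computable.fst.comp (Computable.snd.comp Computable.fst)).pair Computable.snd)
    · rintro p ⟨a, j⟩
      induction j with
      | zero => exact kh p a
      | succ j ih =>
        obtain ⟨m, hm⟩ := ih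
        obtain ⟨l, hl⟩ := gf p (a, j, Nat.rec (z p a) (fun k b => f p (a, k, b)) j)
        refine ⟨max m l, Option.bind_eq_some_iff.2 ⟨_,
          hmono _ _ (a, j) _ (pre_prefix_pre p (le_max_left m l)) hm,
          gm _ _ _ _ (pre_prefix_pre p (le_max_right m l)) hl⟩⟩
  exact main.comp ((of_computable Computable.id).pair hn)

end OracleComputable

/-- Bounded universal quantification of a Boolean predicate. -/
def ballLT (c : ℕ → Bool) (n : ℕ) : Bool := Nat.rec true (fun k b => b && c k) n

lemma ballLT_eq_true {c : ℕ → Bool} {n : ℕ} : ballLT c n = true ↔ ∀ k < n, c k = true := by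
  induction n with
  | zero => simp [ballLT]
  | succ n ih =>
    have e : ballLT c (n + 1) = (ballLT c n && c n) := rfl
    rw [e, Bool.and_eq_true, ih]
    constructor
    · rintro ⟨h, hn⟩ k hk
      rcases Nat.lt_succ_iff_lt_or_eq.1 hk with hk | rfl
      exacts [h k hk, hn]
    · exact fun h => ⟨fun k hk => h k (by omega), h n (by omega)⟩

namespace OracleComputable

lemma ball {n : (ℕ → ℕ) → α → ℕ} {c : (ℕ → ℕ) → α → ℕ → Bool} (hn : OracleComputable n)
    (hc : OracleComputable fun p (x : α × ℕ) => c p x.1 x.2) :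
    OracleComputable fun p a => ballLT (c p a) (n p a) := by
  refine natRec (f := fun p (x : α × ℕ × Bool) => x.2.2 && c p x.1 x.2.1) hn
    (of_computable (Computable.const true)) ?_
  have hx : OracleComputable fun (_ : ℕ → ℕ) (x : α × ℕ × Bool) => (x.1, x.2.1) :=
    of_computable (Computable.fst.pair (Computable.fst.comp Computable.snd))
  exact map₂ (c := fun a b : Bool => a && b) (Primrec.and.to_comp)
    (of_computable (Computable.snd.comp Computable.snd)) (hc.comp hx)

lemma not {c : (ℕ → ℕ) → α → Bool} (hc : OracleComputable c) :
    OracleComputable fun p a => !c p a :=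
  map Primrec.not.to_comp hc

lemma and {c d : (ℕ → ℕ) → α → Bool} (hc : OracleComputable c) (hd : OracleComputable d) :
    OracleComputable fun p a => c p a && d p a :=
  map₂ Primrec.and.to_comp hc hd

lemma cond {c : (ℕ → ℕ) → α → Bool} {f g : (ℕ → ℕ) → α → β} (hc : OracleComputable c)
    (hf : OracleComputable f) (hg : OracleComputable g) :
    OracleComputable fun p a => bif c p a then f p a else g p a :=
  map (c := fun x : Bool × β × β => bif x.1 then x.2.1 else x.2.2)
    (Computable.cond Computable.fst (Computable.fst.comp Computable.snd)
      (Computable.snd.comp Computable.snd)) (hc.pair (hf.pair hg))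

lemma computablePFun {f : (ℕ → ℕ) → ℕ → ℕ} (hf : OracleComputable f) :
    ComputablePFun (f : (ℕ → ℕ) →. (ℕ → ℕ)) := by
  obtain ⟨g, gc, gm, gf⟩ := hf
  refine computablePFun_of_word gc gm fun p q hq i => ?_
  rw [PFun.coe_val, Part.mem_some_iff] at hq
  rw [hq]
  exact gf p i

end OracleComputable

end

/-! ### Search -/

/-- The constant sequence with value `c t`, for the least `t` such that `R p t` holds. -/
def searchPFun (R : (ℕ → ℕ) → ℕ → Bool) (c : ℕ → ℕ) : (ℕ → ℕ) →. (ℕ → ℕ) := fun p =>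
  ⟨∃ t, R p t = true, fun h _ => c (Nat.find h)⟩

/-- The first `t` up to `n` such that `g s t` is not known to be false. -/
def firstUnrefuted (g : List ℕ → ℕ → Option Bool) (s : List ℕ) (n : ℕ) : ℕ :=
  Nat.rec 0 (fun _ k => Option.casesOn (g s k) k fun b => bif b then k else k + 1) n

lemma firstUnrefuted_spec (g : List ℕ → ℕ → Option Bool) (s : List ℕ) (n : ℕ) :
    (∀ t < firstUnrefuted g s n, g s t = some false) ∧ firstUnrefuted g s n ≤ n ∧
      (firstUnrefuted g s n < n → g s (firstUnrefuted g s n) ≠ some false) := by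
  induction n with
  | zero => simp [firstUnrefuted]
  | succ n ih =>
    obtain ⟨h1, h2, h3⟩ := ih
    have e : firstUnrefuted g s (n + 1) = Option.casesOn (g s (firstUnrefuted g s n))
      (firstUnrefuted g s n)
      fun b => bif b then firstUnrefuted g s n else firstUnrefuted g s n + 1 := rfl
    rcases hv : g s (firstUnrefuted g s n) with _ | _ | _ <;>
      simp only [hv, cond_true, cond_false] at e <;> rw [e]
    · exact ⟨h1, by omega, fun _ => by simp [hv]⟩
    · have hn : firstUnrefuted g s n = n := by
        by_contra hne
        exact h3 (by omega) hv
      refine ⟨fun t ht => ?_, by omega, by omega⟩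
      rcases Nat.lt_succ_iff_lt_or_eq.1 ht with ht | rfl
      exacts [h1 t ht, hv]
    · exact ⟨h1, by omega, fun _ => by simp [hv]⟩

/-- The search on a word stops at the first candidate not yet refuted, and nothing is output until
that candidate is confirmed. Output is therefore never revised. -/
lemma ComputablePFun.search {R : (ℕ → ℕ) → ℕ → Bool} (hR : OracleComputable R) {c : ℕ → ℕ}
    (hc : Computable c) : ComputablePFun (searchPFun R c) := by
  obtain ⟨g, gc, gm, gf⟩ := hR
  let k : List ℕ → ℕ := fun s => firstUnrefuted g s s.length
  have kc : Computable k := by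
    refine Computable.nat_rec (f := fun s : List ℕ => s.length) (g := fun _ => 0)
      (h := fun s y => Option.casesOn (g s y.2) y.2 fun b => bif b then y.2 else y.2 + 1)
      Computable.list_length (Computable.const 0) ?_
    have hl : Computable fun x : List ℕ × ℕ × ℕ => x.2.2 :=
      Computable.snd.comp Computable.snd
    exact Computable.option_casesOn (gc.comp Computable.fst hl) hl
      (Computable.cond Computable.snd (hl.comp Computable.fst)
        (Computable.succ.comp (hl.comp Computable.fst)))
  -- All candidates below `k s` are refuted by `s`, hence by `t`, and `k s` itself stays confirmed;
  -- so the search on `t` stops at the same place.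
  have hk : ∀ s t, s <+: t → g s (k s) = some true → k t = k s := by
    intro s t hst hs
    obtain ⟨h1, h2, -⟩ := firstUnrefuted_spec g s s.length
    obtain ⟨h1', -, h3'⟩ := firstUnrefuted_spec g t t.length
    have ht := gm _ _ _ _ hst hs
    have hlen := hst.length_le
    rcases lt_trichotomy (k t) (k s) with h | h | h
    · exact absurd (gm _ _ _ _ hst (h1 _ h)) (h3' (by change k t < _; change k s ≤ _ at h2; omega))
    · exact h
    · rw [h1' _ h] at ht
      cases ht
  refine computablePFun_of_word (g := fun s _ => (g s (k s)).bind
    fun b => bif b then some (c (k s)) else none) ?_ ?_ ?_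
  · have hk1 := kc.comp (Computable.fst (α := List ℕ) (β := ℕ))
    refine Computable.option_bind (gc.comp Computable.fst hk1) ?_
    exact Computable.cond Computable.snd
      (Computable.option_some.comp (hc.comp (hk1.comp Computable.fst))) (Computable.const none)
  · intro s t a b hst h
    obtain ⟨v, hv, hb⟩ := Option.bind_eq_some_iff.1 h
    cases v with
    | false => cases hb
    | true =>
      simp only [hk s t hst hv]
      exact Option.bind_eq_some_iff.2 ⟨true, gm _ _ _ _ hst hv, hb⟩
  · rintro p q ⟨h, rfl⟩ i
    choose N hN using fun t => gf p t
    set T := Nat.find h with hT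
    -- Long enough for the capped search to reach `T`, and for the prefix to decide every candidate
    -- up to `T`.
    let M := max (T + 1) ((Finset.range (T + 1)).sup N)
    have hM : ∀ t ≤ T, g (pre p M) t = some (R p t) := fun t ht =>
      gm _ _ _ _ (pre_prefix_pre p ((Finset.le_sup (Finset.mem_range.2 (by omega))).trans
        (le_max_right _ _))) (hN t)
    have hRT : R p T = true := Nat.find_spec h
    obtain ⟨h1, h2, h3⟩ := firstUnrefuted_spec g (pre p M) (pre p M).length
    have hkT : k (pre p M) = T := by
      rcases lt_trichotomy (k (pre p M)) T with hlt | heq | hgt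
      · have hf : R p (k (pre p M)) = false := by simpa using Nat.find_min h hlt
        refine absurd ((hM _ hlt.le).trans (congrArg some hf)) (h3 ?_)
        change k (pre p M) < _
        rw [length_pre]
        have : T + 1 ≤ M := le_max_left _ _
        omega
      · exact heq
      · have := h1 T hgt
        rw [hM T le_rfl, hRT] at this
        cases this
    refine ⟨M, ?_⟩
    simp only [hkT]
    rw [hM T le_rfl, hRT]
    rfl

/-! ### Composition -/

lemma ComputablePFun.comp {F G : (ℕ → ℕ) →. (ℕ → ℕ)} (hF : ComputablePFun F)
    (hG : ComputablePFun G) : ComputablePFun (F.comp G) := by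
  obtain ⟨φ, φc, φm, hφ⟩ := hF
  obtain ⟨ψ, ψc, ψm, hψ⟩ := hG
  refine ⟨fun s => φ (ψ s), φc.comp ψc, fun s t h => φm _ _ (ψm _ _ h), fun p r hr => ?_⟩
  obtain ⟨q, hq, hr⟩ := Part.mem_bind_iff.1 hr
  obtain ⟨h1, h2⟩ := hφ q r hr
  obtain ⟨h3, h4⟩ := hψ p q hq
  refine ⟨fun n => ?_, fun m => ?_⟩
  · obtain ⟨m, hm⟩ := h3 n
    obtain ⟨l, hl⟩ := h1 m
    exact ⟨l, (congrArg φ hm).trans hl⟩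
  · obtain ⟨n, hn⟩ := h2 m
    obtain ⟨l, hl⟩ := h4 n
    obtain ⟨j, hj⟩ := h3 l
    refine ⟨l, hn.trans (φm _ _ ?_).length_le⟩
    rw [hj, length_pre] at hl
    rw [hj]
    exact pre_prefix_pre q hl

lemma ComputablePFun.id : ComputablePFun (PFun.id (ℕ → ℕ)) :=
  OracleComputable.query.computablePFun

/-! ### Strong Weihrauch reductions -/

section Reductions

variable {X : RepSpace.{u}} {Y : RepSpace.{v}} {Z : RepSpace.{w}} {W : RepSpace.{z}}

lemma SWReducible.of_names {f : MultiFun X Y} {g : MultiFun Z W} {h : (ℕ → ℕ) → ℕ → ℕ}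
    {K : (ℕ → ℕ) →. (ℕ → ℕ)} (hh : OracleComputable h) (hK : ComputablePFun K)
    (H : ∀ p x, X.IsName p x → x ∈ f.dom → ∃ p' ∈ K p, ∃ z ∈ g.dom, Z.IsName p' z ∧
      ∀ q w, W.IsName q w → w ∈ g.val z → ∃ y, Y.IsName (h q) y ∧ y ∈ f.val x) : f ≤sW g := by
  refine ⟨h, K, hh.computablePFun, hK, fun G hG p x hp hx => ?_⟩
  obtain ⟨p', hp', z, hz, hpz, hw⟩ := H p x hp hx
  obtain ⟨q, hq, w, hqw, hwz⟩ := hG p' z hpz hz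
  obtain ⟨y, hy, hyx⟩ := hw q w hqw hwz
  exact ⟨h q, Part.mem_bind (Part.mem_bind hp' hq) (Part.mem_some _), y, hy, hyx⟩

lemma SWReducible.of_names_total {f : MultiFun X Y} {g : MultiFun Z W} {h k : (ℕ → ℕ) → ℕ → ℕ}
    (hh : OracleComputable h) (hk : OracleComputable k)
    (H : ∀ p x, X.IsName p x → x ∈ f.dom → ∃ z ∈ g.dom, Z.IsName (k p) z ∧
      ∀ q w, W.IsName q w → w ∈ g.val z → ∃ y, Y.IsName (h q) y ∧ y ∈ f.val x) : f ≤sW g :=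
  SWReducible.of_names hh hk.computablePFun fun p x hp hx => ⟨k p, Part.mem_some _, H p x hp hx⟩

lemma SWReducible.isComputable {f : MultiFun X Y} {g : MultiFun Z W} (hfg : f ≤sW g)
    (hg : g.IsComputable) : f.IsComputable := by
  obtain ⟨H, K, hH, hK, h⟩ := hfg
  obtain ⟨G, hG, hGg⟩ := hg
  exact ⟨_, hH.comp (hG.comp hK), h G hGg⟩

lemma idProblem_isComputable (X : RepSpace.{u}) : (idProblem X).IsComputable :=
  ⟨PFun.id _, ComputablePFun.id, fun p x hp _ => ⟨p, Part.mem_some _, x, hp, rfl⟩⟩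

end Reductions

/-! ### Cluster points in `ℕ` -/

lemma mapClusterPt_nat_iff {x : ℕ → ℕ} {n : ℕ} :
    MapClusterPt n atTop x ↔ ∃ᶠ t in atTop, x t = n := by
  rw [mapClusterPt_iff_frequently]
  constructor
  · exact fun h => h {n} (by simp)
  · exact fun h s hs => h.mono fun t ht => ht ▸ mem_of_mem_nhds hs

/-- A continuity argument: on the zero sequence a realizer commits to the answer `0` after a finite
prefix, but continuing that prefix with ones leaves `1` as the only cluster point. -/
lemma CLNat_not_isComputable : ¬ CLNat.IsComputable := by
  rintro ⟨F, ⟨φ, -, -, hφ⟩, hF⟩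
  have hval : ∀ (p : ℕ → ℕ) (c : ℕ), (∀ᶠ t in atTop, p t = c) → ∃ q ∈ F p, q 0 = c := by
    intro p c hp
    -- Term `t` of the named sequence is read at position `⟨t, 0⟩ ≥ t`.
    have hc : ∀ᶠ t in atTop, p (Nat.pair t 0) = c :=
      (tendsto_atTop_mono (fun t => Nat.left_le_pair t 0) tendsto_id).eventually hp
    obtain ⟨q, hq, y, hqy, hy⟩ := hF p (fun t => p (Nat.pair t 0)) (fun _ => rfl)
      ⟨c, mapClusterPt_nat_iff.2 hc.frequently⟩
    refine ⟨q, hq, hqy.trans ?_⟩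
    obtain ⟨t, ht, ht'⟩ := ((mapClusterPt_nat_iff.1 hy).and_eventually hc).exists
    exact ht.symm.trans ht'
  obtain ⟨q, hq, hq0⟩ := hval (fun _ => 0) 0 (Eventually.of_forall fun _ => rfl)
  obtain ⟨h1, h2⟩ := hφ _ q hq
  obtain ⟨n, hn⟩ := h2 1
  obtain ⟨m, hm⟩ := h1 n
  obtain ⟨q', hq', hq0'⟩ := hval (fun t => if t < n then 0 else 1) 1
    ((eventually_ge_atTop n).mono fun t ht => if_neg (not_lt.2 ht))
  obtain ⟨m', hm'⟩ := (hφ _ q' hq').1 n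
  have hpre : pre (fun t => if t < n then 0 else 1) n = pre (fun _ => 0) n :=
    List.map_congr_left fun t ht => if_pos (List.mem_range.1 ht)
  rw [hpre] at hm'
  have e1 : (φ (pre (fun _ => 0) n))[0]? = some 0 := by
    rw [hm, length_pre] at hn
    rw [hm, getElem?_pre (by omega), hq0]
  have e2 : (φ (pre (fun _ => 0) n))[0]? = some 1 := by
    rw [hm', length_pre] at hn
    rw [hm', getElem?_pre (by omega), hq0']
  rw [e1] at e2
  cases e2

/-- Every index `n < N` has a witness `m < w`. -/
def witnessesBelow (R : ℕ → ℕ → Bool) (N w : ℕ) : Bool :=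
  ballLT (fun n => !ballLT (fun m => !R n m) w) N

lemma witnessesBelow_eq_true {R : ℕ → ℕ → Bool} {N w : ℕ} :
    witnessesBelow R N w = true ↔ ∀ n < N, ∃ m < w, R n m = true := by
  simp only [witnessesBelow, ballLT_eq_true, Bool.not_eq_true', ← Bool.not_eq_true]
  simp

/-- `w` is the least bound such that every index `n < N` has a witness below `w`. -/
def leastBound (R : ℕ → ℕ → Bool) (N w : ℕ) : Bool :=
  witnessesBelow R N w && ballLT (fun w' => !witnessesBelow R N w') w

lemma leastBound_eq_true {R : ℕ → ℕ → Bool} {N w : ℕ} :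
    leastBound R N w = true ↔
      witnessesBelow R N w = true ∧ ∀ w' < w, witnessesBelow R N w' = false := by
  simp [leastBound, ballLT_eq_true]

/-- A sequence with cluster points `2 * e` for those `e` with `∀ n, ∃ m, R e n m`. -/
def emission (R : ℕ → ℕ → ℕ → Bool) (t : ℕ) : ℕ :=
  bif leastBound (R t.unpair.1) t.unpair.2.unpair.1 t.unpair.2.unpair.2
  then 2 * t.unpair.1 else 2 * t + 1

/-- A time codes `⟨e, ⟨N, w⟩⟩`. For fixed `e` and `N` at most one `w` is the least bound, so `2 * e`
is emitted at most once per `N`, and infinitely often exactly when every `N` has a bound. The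
fillers `2 * t + 1` are pairwise distinct and never cluster. -/
lemma frequently_emission_iff {R : ℕ → ℕ → ℕ → Bool} {v : ℕ} :
    (∃ᶠ t in atTop, emission R t = v) ↔ ∃ e, v = 2 * e ∧ ∀ n, ∃ m, R e n m = true := by
  constructor
  · intro h
    -- For `t > v` the filler `2 * t + 1` exceeds `v`, so `v` can only come from a genuine emission.
    have hcase : ∀ t, v < t → emission R t = v → v = 2 * t.unpair.1 ∧
        leastBound (R t.unpair.1) t.unpair.2.unpair.1 t.unpair.2.unpair.2 = true := by
      intro t ht htv
      rw [emission] at htv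
      cases hb : leastBound (R t.unpair.1) t.unpair.2.unpair.1 t.unpair.2.unpair.2
      · rw [hb, cond_false] at htv
        omega
      · rw [hb, cond_true] at htv
        exact ⟨htv.symm, rfl⟩
    obtain ⟨t, hvt, ht⟩ := ((eventually_gt_atTop v).and_frequently h).exists
    obtain ⟨he, -⟩ := hcase t hvt ht
    refine ⟨t.unpair.1, he, ?_⟩
    generalize t.unpair.1 = e at he
    by_contra! hn
    obtain ⟨n, hn⟩ := hn
    have hW : ∀ N, ∃ W, ∀ w, leastBound (R e) N w = true → w = W := by
      intro N
      by_cases hex : ∃ W, leastBound (R e) N W = true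
      · obtain ⟨W, hWN⟩ := hex
        refine ⟨W, fun w hw => ?_⟩
        rw [leastBound_eq_true] at hWN hw
        by_contra hne
        rcases lt_or_gt_of_ne hne with hlt | hlt
        · exact absurd hw.1 (by simp [hWN.2 w hlt])
        · exact absurd hWN.1 (by simp [hw.2 W hlt])
      · exact ⟨0, fun w hw => absurd ⟨w, hw⟩ hex⟩
    choose W hW using hW
    -- If `n` has no witness, no `N > n` has a bound, so after time `v` only the times with `N ≤ n`
    -- are left.
    have hfin : ((fun N => Nat.pair e (Nat.pair N (W N))) '' Set.Iic n).Finite :=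
      (Set.finite_Iic n).image _
    refine Nat.frequently_atTop_iff_infinite.1 ((eventually_gt_atTop v).and_frequently h)
      (hfin.subset ?_)
    rintro s ⟨hvs, hs⟩
    obtain ⟨he', hb⟩ := hcase s hvs hs
    have hes : s.unpair.1 = e := by omega
    rw [hes] at hb
    refine ⟨s.unpair.2.unpair.1, ?_, ?_⟩
    · by_contra hlt
      obtain ⟨m, -, hm⟩ := witnessesBelow_eq_true.1 (leastBound_eq_true.1 hb).1 n
        (not_le.1 hlt)
      exact hn m hm
    · simp only [← hW _ _ hb, ← hes, Nat.pair_unpair]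
  · rintro ⟨e, rfl, he⟩
    choose m hm using he
    refine frequently_atTop.2 fun N => ?_
    have hex : ∃ w, witnessesBelow (R e) N w = true :=
      ⟨(Finset.range N).sup m + 1, witnessesBelow_eq_true.2 fun n hn =>
        ⟨m n, Nat.lt_succ_iff.2 (Finset.le_sup (Finset.mem_range.2 hn)), hm n⟩⟩
    have hb : leastBound (R e) N (Nat.find hex) = true :=
      leastBound_eq_true.2 ⟨Nat.find_spec hex, fun w' hw' => by simpa using Nat.find_min hex hw'⟩
    exact ⟨Nat.pair e (Nat.pair N (Nat.find hex)),
      (Nat.left_le_pair _ _).trans (Nat.right_le_pair _ _), by simp [emission, hb]⟩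

lemma computable_unpair_fst : Computable fun n : ℕ => n.unpair.1 :=
  Computable.fst.comp Computable.unpair

lemma computable_unpair_snd : Computable fun n : ℕ => n.unpair.2 :=
  Computable.snd.comp Computable.unpair

lemma OracleComputable.emission {R : (ℕ → ℕ) → ℕ → ℕ → ℕ → Bool}
    (hR : OracleComputable fun p (x : ℕ × ℕ × ℕ) => R p x.1 x.2.1 x.2.2) :
    OracleComputable fun p t => emission (R p) t := by
  have hw : OracleComputable fun p (x : ℕ × ℕ × ℕ) =>
      witnessesBelow (R p x.1) x.2.1 x.2.2 := by
    refine ball (n := fun _ (x : ℕ × ℕ × ℕ) => x.2.1)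
      (c := fun p (x : ℕ × ℕ × ℕ) n => !ballLT (fun m => !R p x.1 n m) x.2.2)
      (of_computable (Computable.fst.comp Computable.snd)) ?_
    refine not (ball (n := fun _ (y : (ℕ × ℕ × ℕ) × ℕ) => y.1.2.2)
      (c := fun p (y : (ℕ × ℕ × ℕ) × ℕ) m => !R p y.1.1 y.2 m)
      (of_computable (Computable.snd.comp (Computable.snd.comp Computable.fst))) ?_)
    exact not (hR.comp (h := fun _ (z : ((ℕ × ℕ × ℕ) × ℕ) × ℕ) => (z.1.1.1, z.1.2, z.2))
      (of_computable ((Computable.fst.comp (Computable.fst.comp Computable.fst)).pair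
        ((Computable.snd.comp Computable.fst).pair Computable.snd))))
  have hl : OracleComputable fun p (x : ℕ × ℕ × ℕ) => leastBound (R p x.1) x.2.1 x.2.2 := by
    refine hw.and (ball (n := fun _ (x : ℕ × ℕ × ℕ) => x.2.2)
      (c := fun p (x : ℕ × ℕ × ℕ) w => !witnessesBelow (R p x.1) x.2.1 w)
      (of_computable (Computable.snd.comp Computable.snd)) ?_)
    exact not (hw.comp (h := fun _ (y : (ℕ × ℕ × ℕ) × ℕ) => (y.1.1, y.1.2.1, y.2))
      (of_computable ((Computable.fst.comp Computable.fst).pair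
        ((Computable.fst.comp (Computable.snd.comp Computable.fst)).pair Computable.snd))))
  have hmul : Computable fun n : ℕ => 2 * n :=
    (Primrec.nat_mul.comp (Primrec.const 2) Primrec.id).to_comp
  refine cond (hl.comp (h := fun _ (t : ℕ) => (t.unpair.1, t.unpair.2.unpair.1,
    t.unpair.2.unpair.2)) (of_computable ?_)) (of_computable (hmul.comp computable_unpair_fst))
    (of_computable (Computable.succ.comp hmul))
  exact computable_unpair_fst.pair ((computable_unpair_fst.comp computable_unpair_snd).pair
    (computable_unpair_snd.comp computable_unpair_snd))

/-! ### Approximate distances -/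

variable {X : Type u} [MetricSpace X] (𝒳 : ComputableMetric X)

/-- Strict comparison of computable reals is undecidable, so a gap is left. A rational approximation
with error `2⁻ᵏ` is compared with `2 · 2⁻ᵏ`; clearing denominators makes this a comparison of
natural numbers. -/
lemma ComputableMetric.exists_near : ∃ near : ℕ × ℕ × ℕ → Bool, Computable near ∧
    ∀ n m k, (near (n, m, k) = true → dist (𝒳.α n) (𝒳.α m) < 3 * (1 / 2 : ℝ) ^ k) ∧
      (dist (𝒳.α n) (𝒳.α m) < (1 / 2 : ℝ) ^ k → near (n, m, k) = true) := by
  obtain ⟨a, b, ha, hb, hab⟩ := 𝒳.computable_dist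
  have hpow : Computable fun x : ℕ × ℕ × ℕ => 2 ^ x.2.2 :=
    (Primrec₂.unpaired'.1 Nat.Primrec.pow).to_comp.comp (Computable.const 2)
      (Computable.snd.comp Computable.snd)
  refine ⟨fun x => decide (a x * 2 ^ x.2.2 < 2 * (b x + 1)), ?_, fun n m k => ?_⟩
  · exact Primrec.nat_lt.decide.to_comp.comp (Primrec.nat_mul.to_comp.comp ha hpow)
      (Primrec.nat_mul.to_comp.comp (Computable.const 2) (Computable.succ.comp hb))
  · have h := abs_le.1 (hab n m k)
    have hiff : (a (n, m, k) * 2 ^ k < 2 * (b (n, m, k) + 1)) ↔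
        (a (n, m, k) : ℝ) / ((b (n, m, k) : ℝ) + 1) < 2 * (1 / 2 : ℝ) ^ k := by
      have hb0 : (0 : ℝ) < (b (n, m, k) : ℝ) + 1 := by positivity
      rw [div_lt_iff₀ hb0, one_div, inv_pow, ← Nat.cast_lt (α := ℝ)]
      push_cast
      have h2 : (0 : ℝ) < 2 ^ k := by positivity
      rw [← mul_lt_mul_iff_left₀ h2 (b := (a (n, m, k) : ℝ))]
      have e : 2 * ((2 : ℝ) ^ k)⁻¹ * ((b (n, m, k) : ℝ) + 1) * 2 ^ k
          = 2 * ((b (n, m, k) : ℝ) + 1) := by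
        field_simp
      rw [e]
    simp only [decide_eq_true_eq, hiff]
    constructor <;> intro h' <;> linarith [h.1, h.2]

namespace ComputableMetric

/-- A decidable relation between `d(α n, α m) < 2⁻ᵏ` and `d(α n, α m) < 3 · 2⁻ᵏ`. -/
noncomputable def near (n m k : ℕ) : Bool := 𝒳.exists_near.choose (n, m, k)

lemma computable_near : Computable fun x : ℕ × ℕ × ℕ => 𝒳.near x.1 x.2.1 x.2.2 :=
  𝒳.exists_near.choose_spec.1

variable {𝒳} in
lemma dist_lt_of_near {n m k : ℕ} (h : 𝒳.near n m k = true) :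
    dist (𝒳.α n) (𝒳.α m) < 3 * (1 / 2 : ℝ) ^ k :=
  (𝒳.exists_near.choose_spec.2 n m k).1 h

variable {𝒳} in
lemma near_of_dist_lt {n m k : ℕ} (h : dist (𝒳.α n) (𝒳.α m) < (1 / 2 : ℝ) ^ k) :
    𝒳.near n m k = true :=
  (𝒳.exists_near.choose_spec.2 n m k).2 h

/-- The `m`-th member of the `i`-th set named by `p` is a point that is close to `α n`, as far as
can be seen with precision `2⁻ˡ`. -/
noncomputable def hit (p : ℕ → ℕ) (i m n l : ℕ) : Bool :=
  decide (p (Nat.pair i (Nat.pair m 0)) = 0) &&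
    𝒳.near (p (Nat.pair i (Nat.pair m (l + 2)))) n l

end ComputableMetric

open ComputableMetric

lemma dist_le_of_isName {r : ℕ → ℕ} {x : X} (h : (cauchySpace 𝒳).IsName r x) (k : ℕ) :
    dist x (𝒳.α (r k)) ≤ (1 / 2 : ℝ) ^ k :=
  le_of_tendsto (h.2.dist tendsto_const_nhds)
    ((eventually_ge_atTop k).mono fun n hn => (h.1 k n hn).le)

section Hit

variable {𝒳} {p : ℕ → ℕ} {A : ℕ → TopologicalSpace.Closeds X}

lemma exists_mem_of_hit (hp : (seqSpace (closedPos 𝒳)).IsName p A) {i m n l : ℕ}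
    (h : 𝒳.hit p i m n l = true) : ∃ y ∈ A i, dist y (𝒳.α n) < 4 * (1 / 2 : ℝ) ^ l := by
  obtain ⟨y, hy, hA⟩ := hp i
  rw [hit, Bool.and_eq_true, decide_eq_true_eq] at h
  rcases hy m with ⟨-, h0⟩ | ⟨x, hx, -, hxn⟩
  · exact absurd h.1 h0
  · refine ⟨x, ?_, ?_⟩
    · rw [← SetLike.mem_coe, ← hA]
      exact subset_closure ⟨m, hx⟩
    -- Entry `l + 2` is term `l + 1` of the Cauchy name, because entry `0` is the coproduct flag.
    -- The errors add up to `(1/2 + 3) · 2⁻ˡ`.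
    · have h1 := dist_le_of_isName 𝒳 hxn (l + 1)
      have h2 := dist_lt_of_near h.2
      have h3 := dist_triangle x (𝒳.α (p (Nat.pair i (Nat.pair m (l + 1 + 1))))) (𝒳.α n)
      have h4 : (1 / 2 : ℝ) ^ (l + 1) = (1 / 2 : ℝ) ^ l / 2 := by ring
      have h5 : (0 : ℝ) < (1 / 2 : ℝ) ^ l := by positivity
      linarith

lemma exists_hit_of_mem (hp : (seqSpace (closedPos 𝒳)).IsName p A) {i n l : ℕ} {y : X}
    (hyA : y ∈ A i) (hyn : dist y (𝒳.α n) < (1 / 2 : ℝ) ^ (l + 1)) :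
    ∃ m, 𝒳.hit p i m n l = true := by
  obtain ⟨f, hf, hA⟩ := hp i
  rw [← SetLike.mem_coe, ← hA] at hyA
  obtain ⟨x, hxn, m, hm⟩ := mem_closure_iff.1 hyA _ Metric.isOpen_ball
    (Metric.mem_ball.2 hyn)
  refine ⟨m, ?_⟩
  rcases hf m with ⟨hn, -⟩ | ⟨x', hx', h0, hxn'⟩
  · rw [hm] at hn
    cases hn
  · obtain rfl : x = x' := Option.some.inj (hm.symm.trans hx')
    rw [hit, Bool.and_eq_true, decide_eq_true_eq]
    refine ⟨h0, near_of_dist_lt ?_⟩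
    have h1 := dist_le_of_isName 𝒳 hxn' (l + 1)
    have h3 := dist_triangle_left (𝒳.α (p (Nat.pair i (Nat.pair m (l + 1 + 1))))) (𝒳.α n) x
    have h4 : (1 / 2 : ℝ) ^ (l + 1) = (1 / 2 : ℝ) ^ l / 2 := by ring
    rw [Metric.mem_ball] at hxn
    linarith

end Hit

lemma OracleComputable.hit {α : Type*} [Primcodable α] {i m n l : α → ℕ} (hi : Computable i)
    (hm : Computable m) (hn : Computable n) (hl : Computable l) :
    OracleComputable fun p a => 𝒳.hit p (i a) (m a) (n a) (l a) := by
  have hpair : Computable₂ Nat.pair := Primrec₂.natPair.to_comp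
  refine OracleComputable.and ?_ ?_
  · refine map (c := fun k : ℕ => decide (k = 0)) ?_ (query.comp (of_computable
      (hpair.comp hi (hpair.comp hm (Computable.const 0)))))
    exact (Primrec.eq.decide.comp Primrec.id (Primrec.const 0)).to_comp
  · refine map (𝒳.computable_near) (OracleComputable.pair (query.comp (of_computable
      (hpair.comp hi (hpair.comp hm (Computable.succ.comp (Computable.succ.comp hl))))))
      (of_computable (hn.pair hl)))

/-! ### The upper bound for `BCT₃` -/

/-- If the point `α c` with `n = ⟨c, l⟩` is close to `α a` with `e = ⟨i, ⟨a, k⟩⟩`, then the `m`-th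
member of the `i`-th set is close to `α c`. -/
noncomputable def ballTest (p : ℕ → ℕ) (e n m : ℕ) : Bool :=
  !(𝒳.near n.unpair.1 e.unpair.2.unpair.1 e.unpair.2.unpair.2 &&
    !𝒳.hit p e.unpair.1 m n.unpair.1 n.unpair.2)

lemma ballTest_eq_true {p : ℕ → ℕ} {i a k c l m : ℕ} :
    ballTest 𝒳 p (Nat.pair i (Nat.pair a k)) (Nat.pair c l) m = true ↔
      (𝒳.near c a k = true → 𝒳.hit p i m c l = true) := by
  simp only [ballTest, Nat.unpair_pair]
  cases 𝒳.near c a k <;> cases 𝒳.hit p i m c l <;> decide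

lemma OracleComputable.ballTest :
    OracleComputable fun p (x : ℕ × ℕ × ℕ) => ballTest 𝒳 p x.1 x.2.1 x.2.2 := by
  have he : Computable fun x : ℕ × ℕ × ℕ => x.1 := Computable.fst
  have hn : Computable fun x : ℕ × ℕ × ℕ => x.2.1 := Computable.fst.comp Computable.snd
  have hm : Computable fun x : ℕ × ℕ × ℕ => x.2.2 := Computable.snd.comp Computable.snd
  have h1 := of_computable (Computable.comp (f := fun x : ℕ × ℕ × ℕ => 𝒳.near x.1 x.2.1 x.2.2)
    𝒳.computable_near ((computable_unpair_fst.comp hn).pair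
      ((computable_unpair_fst.comp (computable_unpair_snd.comp he)).pair
        (computable_unpair_snd.comp (computable_unpair_snd.comp he)))))
  have h2 := OracleComputable.hit 𝒳 (computable_unpair_fst.comp he) hm
    (computable_unpair_fst.comp hn) (computable_unpair_snd.comp hn)
  exact not (h1.and (not h2))

lemma exists_pow_half_mul_lt {ε : ℝ} (hε : 0 < ε) : ∃ k : ℕ, 4 * (1 / 2 : ℝ) ^ k < ε := by
  obtain ⟨k, hk⟩ := exists_pow_lt_of_lt_one (show (0 : ℝ) < ε / 4 by positivity)
    (show (1 / 2 : ℝ) < 1 by norm_num)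
  exact ⟨k, by linarith⟩

section Interior

variable {𝒳} {p : ℕ → ℕ} {A : ℕ → TopologicalSpace.Closeds X}

/-- Every `α c` in the coded ball is approximated by points of `A i` to every precision, so density
of `α` and closedness of `A i` put the whole ball into `A i`. -/
lemma interior_nonempty_of_ballTest (hp : (seqSpace (closedPos 𝒳)).IsName p A) {e : ℕ}
    (h : ∀ n, ∃ m, ballTest 𝒳 p e n m = true) :
    (interior (A e.unpair.1 : Set X)).Nonempty := by
  obtain ⟨i, a, k, rfl⟩ : ∃ i a k, e = Nat.pair i (Nat.pair a k) :=
    ⟨e.unpair.1, e.unpair.2.unpair.1, e.unpair.2.unpair.2, by simp⟩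
  rw [Nat.unpair_pair]
  refine ⟨𝒳.α a, mem_interior.2 ⟨Metric.ball (𝒳.α a) ((1 / 2 : ℝ) ^ k), fun z hz => ?_,
    Metric.isOpen_ball, Metric.mem_ball_self (by positivity)⟩⟩
  rw [← (A i).isClosed.closure_eq, Metric.mem_closure_iff]
  intro ε hε
  obtain ⟨l, hl⟩ := exists_pow_half_mul_lt (half_pos hε)
  obtain ⟨c, hca, hcz⟩ := 𝒳.dense.exists_mem_open (Metric.isOpen_ball.inter Metric.isOpen_ball)
    ⟨z, hz, Metric.mem_ball_self (half_pos hε)⟩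
  obtain ⟨m, hm⟩ := h (Nat.pair c l)
  obtain ⟨y, hy, hyc⟩ := exists_mem_of_hit hp
    ((ballTest_eq_true 𝒳).1 hm (near_of_dist_lt (Metric.mem_ball.1 hca)))
  refine ⟨y, hy, ?_⟩
  have h1 := dist_triangle z (𝒳.α c) y
  rw [dist_comm z (𝒳.α c), dist_comm (𝒳.α c) y] at h1
  have h2 := Metric.mem_ball.1 hcz
  linarith

lemma exists_ballTest_of_interior_nonempty (hp : (seqSpace (closedPos 𝒳)).IsName p A) {i : ℕ}
    (h : (interior (A i : Set X)).Nonempty) :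
    ∃ e, e.unpair.1 = i ∧ ∀ n, ∃ m, ballTest 𝒳 p e n m = true := by
  obtain ⟨a, ha⟩ := 𝒳.dense.exists_mem_open isOpen_interior h
  obtain ⟨ε, hε, hball⟩ := Metric.mem_nhds_iff.1 (mem_interior_iff_mem_nhds.1 ha)
  -- The test `near` may accept points at distance up to `3 · 2⁻ᵏ`; these must still lie in the
  -- `ε`-ball inside `A i`.
  obtain ⟨k, hk⟩ := exists_pow_half_mul_lt hε
  refine ⟨Nat.pair i (Nat.pair a k), by simp, fun n => ?_⟩
  obtain ⟨c, l, rfl⟩ : ∃ c l, n = Nat.pair c l := ⟨n.unpair.1, n.unpair.2, by simp⟩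
  by_cases hc : 𝒳.near c a k = true
  · have hk0 : (0 : ℝ) < (1 / 2 : ℝ) ^ k := by positivity
    have hcA : 𝒳.α c ∈ A i :=
      hball (Metric.mem_ball.2 (by linarith [dist_lt_of_near hc]))
    obtain ⟨m, hm⟩ := exists_hit_of_mem hp (n := c) (l := l) hcA
      (by rw [dist_self]; positivity)
    exact ⟨m, (ballTest_eq_true 𝒳).2 fun _ => hm⟩
  · exact ⟨0, (ballTest_eq_true 𝒳).2 fun h => absurd h hc⟩

end Interior

theorem BCT₃_le_CLNat [CompleteSpace X] : BCT₃ 𝒳 ≤sW CLNat := by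
  have hh : OracleComputable fun (q : ℕ → ℕ) (_ : ℕ) => (q 0 / 2).unpair.1 :=
    OracleComputable.map (c := fun n : ℕ => (n / 2).unpair.1) (computable_unpair_fst.comp
      (Primrec.nat_div.comp Primrec.id (Primrec.const 2)).to_comp)
      (OracleComputable.query.comp (OracleComputable.of_computable (Computable.const 0)))
  have hk : OracleComputable fun (p : ℕ → ℕ) (u : ℕ) => emission (ballTest 𝒳 p) u.unpair.1 :=
    (OracleComputable.emission (OracleComputable.ballTest 𝒳)).comp
      (OracleComputable.of_computable computable_unpair_fst)
  refine SWReducible.of_names_total hh hk fun p A hp hA => ?_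
  refine ⟨emission (ballTest 𝒳 p), ?_, fun t => by simp, ?_⟩
  -- Baire's theorem enters here: it ensures that the emitted sequence has a cluster point.
  · obtain ⟨i, hi⟩ := (BCT₃ 𝒳).nonempty A hA
    obtain ⟨e, -, he⟩ := exists_ballTest_of_interior_nonempty hp hi
    exact ⟨2 * e, mapClusterPt_nat_iff.2 (frequently_emission_iff.2 ⟨e, rfl, he⟩)⟩
  · intro q v hq hv
    obtain ⟨e, rfl, he⟩ := frequently_emission_iff.1 (mapClusterPt_nat_iff.1 hv)
    refine ⟨e.unpair.1, ?_, interior_nonempty_of_ballTest hp he⟩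
    have hq' : q 0 = 2 * e := hq
    simp [hq']

/-! ### Closed sets enumerated by indices of the dense sequence -/

/-- A name of the sequence of the sets `closure {α n | ∃ k, c i ⟨k, n⟩}`. -/
def enumName (c : ℕ → ℕ → Bool) (u : ℕ) : ℕ :=
  bif decide (u.unpair.2.unpair.2 = 0) then
    bif c u.unpair.1 u.unpair.2.unpair.1 then 0 else 1
  else u.unpair.2.unpair.1.unpair.2

/-- The set `closure {α n | ∃ k, c i ⟨k, n⟩}`. -/
def enumClosed (c : ℕ → ℕ → Bool) (i : ℕ) : TopologicalSpace.Closeds X :=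
  ⟨closure {x | ∃ m, c i m = true ∧ 𝒳.α m.unpair.2 = x}, isClosed_closure⟩

lemma isName_const_cauchySpace (n : ℕ) : (cauchySpace 𝒳).IsName (fun _ => n) (𝒳.α n) :=
  ⟨fun k _ _ => by rw [dist_self]; positivity, tendsto_const_nhds⟩

/-- The `m`-th member, with `m = ⟨k, n⟩`, is either `∞` or `α n`, whose Cauchy name can be taken
constantly `n`. -/
lemma isName_enumName (c : ℕ → ℕ → Bool) :
    (seqSpace (closedPos 𝒳)).IsName (enumName c) (enumClosed 𝒳 c) := by
  intro i
  obtain ⟨y, hy⟩ : ∃ y : ℕ → Option X, ∀ m, (c i m = true → y m = some (𝒳.α m.unpair.2)) ∧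
      (c i m = false → y m = none) :=
    ⟨fun m => bif c i m then some (𝒳.α m.unpair.2) else none, fun m => by
      constructor <;> intro h <;> simp only [h, cond_true, cond_false]⟩
  refine ⟨y, fun m => ?_, ?_⟩
  · cases hc : c i m
    · exact Or.inl ⟨(hy m).2 hc, by simp [enumName, hc]⟩
    · refine Or.inr ⟨𝒳.α m.unpair.2, (hy m).1 hc, by simp [enumName, hc], ?_⟩
      have e : (fun n => enumName c (Nat.pair i (Nat.pair m (n + 1)))) =
          fun _ => m.unpair.2 := by
        funext n
        simp [enumName]
      exact e ▸ isName_const_cauchySpace 𝒳 m.unpair.2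
  · change closure _ = closure _
    congr 1
    ext x
    refine exists_congr fun m => ?_
    cases hc : c i m
    · simp [(hy m).2 hc]
    · simp [(hy m).1 hc]

lemma OracleComputable.enumName {c : (ℕ → ℕ) → ℕ → ℕ → Bool}
    (hc : OracleComputable fun p (x : ℕ × ℕ) => c p x.1 x.2) :
    OracleComputable fun p u => enumName (c p) u := by
  have h1 := computable_unpair_fst.comp computable_unpair_snd
  refine cond (of_computable ?_) (cond (hc.comp (h := fun _ (u : ℕ) =>
    (u.unpair.1, u.unpair.2.unpair.1)) (of_computable (computable_unpair_fst.pair h1)))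
    (of_computable (Computable.const 0)) (of_computable (Computable.const 1)))
    (of_computable (computable_unpair_snd.comp h1))
  exact (Primrec.eq.decide.comp Primrec.id (Primrec.const 0)).to_comp.comp
    (computable_unpair_snd.comp computable_unpair_snd)

/-! ### The lower bound for perfect spaces -/

lemma interior_eq_empty_of_finite [PerfectSpace X] {s : Set X} (hs : s.Finite) :
    interior s = ∅ := by
  by_contra h
  obtain ⟨x, hx⟩ := Set.nonempty_iff_ne_empty.2 h
  have := perfectSpace_iff_forall_not_isolated.1 ‹PerfectSpace X› x
  exact infinite_of_mem_nhds x (mem_interior_iff_mem_nhds.1 hx) hs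

/-- `α n` becomes a member of the `i`-th set at a stage `k ≥ n` with `x k = i`. -/
def occurrence (x : ℕ → ℕ) (i m : ℕ) : Bool :=
  decide (x m.unpair.1 = i) && decide (m.unpair.2 ≤ m.unpair.1)

variable {𝒳} in
lemma enumClosed_occurrence_eq_univ {x : ℕ → ℕ} {i : ℕ} (h : ∃ᶠ t in atTop, x t = i) :
    (enumClosed 𝒳 (occurrence x) i : Set X) = Set.univ := by
  refine (𝒳.dense.mono ?_).closure_eq
  rintro _ ⟨n, rfl⟩
  obtain ⟨t, hnt, ht⟩ := frequently_atTop.1 h n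
  exact ⟨Nat.pair t n, by simp [occurrence, ht, hnt], by simp⟩

variable {𝒳} in
-- If `i` does not occur from stage `N` on, only indices below `N` were enumerated. The set is then
-- finite, hence already closed, and perfectness empties its interior.
lemma interior_enumClosed_occurrence [PerfectSpace X] {x : ℕ → ℕ} {i : ℕ}
    (h : ¬ ∃ᶠ t in atTop, x t = i) :
    interior (enumClosed 𝒳 (occurrence x) i : Set X) = ∅ := by
  rw [not_frequently, eventually_atTop] at h
  obtain ⟨N, hN⟩ := h
  have hfin : {y | ∃ m, occurrence x i m = true ∧ 𝒳.α m.unpair.2 = y}.Finite := by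
    refine ((Set.finite_Iio N).image 𝒳.α).subset ?_
    rintro _ ⟨m, hm, rfl⟩
    rw [occurrence, Bool.and_eq_true, decide_eq_true_eq, decide_eq_true_eq] at hm
    refine ⟨_, ?_, rfl⟩
    by_contra hlt
    exact hN _ ((not_lt.1 hlt).trans hm.2) hm.1
  change interior (closure _) = ∅
  rw [hfin.isClosed.closure_eq]
  exact interior_eq_empty_of_finite hfin

theorem CLNat_le_BCT₃ [CompleteSpace X] [PerfectSpace X] : CLNat ≤sW BCT₃ 𝒳 := by
  have hpair : Computable₂ Nat.pair := Primrec₂.natPair.to_comp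
  have hm : Computable fun x : ℕ × ℕ => x.2 := Computable.snd
  have hk : OracleComputable fun (p : ℕ → ℕ) (u : ℕ) =>
      enumName (occurrence fun t => p (Nat.pair t 0)) u := by
    refine OracleComputable.enumName
      (c := fun (p : ℕ → ℕ) => occurrence fun t => p (Nat.pair t 0))
      (OracleComputable.and ?_ (OracleComputable.of_computable ?_))
    · refine OracleComputable.map₂ (c := fun a b : ℕ => decide (a = b)) Primrec.eq.decide.to_comp
        (OracleComputable.query.comp (OracleComputable.of_computable
          (hpair.comp (computable_unpair_fst.comp hm) (Computable.const 0))))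
        (OracleComputable.of_computable Computable.fst)
    · exact Primrec.nat_le.decide.to_comp.comp (computable_unpair_snd.comp hm)
        (computable_unpair_fst.comp hm)
  refine SWReducible.of_names_total OracleComputable.query hk fun p x hp hx => ?_
  have hpx : (fun t => p (Nat.pair t 0)) = x := funext hp
  refine ⟨enumClosed 𝒳 (occurrence x), ?_, hpx ▸ isName_enumName 𝒳 _, fun q i hq hi => ?_⟩
  · obtain ⟨i, hi⟩ := hx
    exact Set.eq_univ_of_univ_subset ((enumClosed_occurrence_eq_univ
      (mapClusterPt_nat_iff.1 hi)).ge.trans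
        (Set.subset_iUnion (fun i => (enumClosed 𝒳 (occurrence x) i : Set X)) i))
  · refine ⟨i, hq, mapClusterPt_nat_iff.2 ?_⟩
    by_contra h
    have hi' : (interior (enumClosed 𝒳 (occurrence x) i : Set X)).Nonempty := hi
    rw [interior_enumClosed_occurrence h] at hi'
    exact Set.not_nonempty_empty hi'

/-! ### Spaces with isolated points -/

/-- Take `A n = X` and all other sets empty; then `n` is the only correct answer. -/
lemma idNat_le_BCT₃ [CompleteSpace X] : idNat ≤sW BCT₃ 𝒳 := by
  have hk : OracleComputable fun (p : ℕ → ℕ) (u : ℕ) =>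
      enumName (fun i _ => decide (p 0 = i)) u :=
    OracleComputable.enumName (c := fun (p : ℕ → ℕ) i _ => decide (p 0 = i))
      (OracleComputable.map₂ (c := fun a b : ℕ => decide (a = b)) Primrec.eq.decide.to_comp
        (OracleComputable.query.comp (OracleComputable.of_computable (Computable.const 0)))
        (OracleComputable.of_computable Computable.fst))
  refine SWReducible.of_names_total OracleComputable.query hk fun p n hp _ => ?_
  have hpn : p 0 = n := hp
  refine ⟨_, ?_, isName_enumName 𝒳 _, fun q i hq hi => ⟨i, hq, ?_⟩⟩
  · refine Set.eq_univ_of_univ_subset (Set.Subset.trans ?_ (Set.subset_iUnion (fun i =>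
      (enumClosed 𝒳 (fun i _ => decide (p 0 = i)) i : Set X)) n))
    refine ((𝒳.dense.mono ?_).closure_eq).ge
    rintro _ ⟨k, rfl⟩
    exact ⟨Nat.pair 0 k, by simp [hpn], by simp⟩
  · by_contra hne
    have hne' : n ≠ i := fun h => hne h.symm
    obtain ⟨x, hx⟩ := hi
    have hx' := interior_subset hx
    change x ∈ closure _ at hx'
    simp [hpn, hne'] at hx'

lemma idZero_le_BCT₂ [CompleteSpace X] : idZero ≤sW BCT₂ 𝒳 := by
  have hk : OracleComputable fun (_ : ℕ → ℕ) (u : ℕ) => enumName (fun _ _ => false) u :=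
    OracleComputable.enumName (c := fun _ _ _ => false)
      (OracleComputable.of_computable (Computable.const false))
  refine SWReducible.of_names_total (OracleComputable.of_computable (Computable.const 0)) hk
    fun p n _ _ => ⟨_, fun i => ?_, isName_enumName 𝒳 _, fun q x _ _ => ⟨n, n.2.symm, rfl⟩⟩
  change interior (closure _) = ∅
  simp

/-- The dense sequence must meet the open singleton of an isolated point. -/
lemma exists_isOpen_singleton (h : ¬ PerfectSpace X) : ∃ n, IsOpen {𝒳.α n} := by
  rw [perfectSpace_iff_forall_not_isolated] at h
  push Not at h
  obtain ⟨x, hx⟩ := h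
  have hx' : IsOpen {x} := isOpen_singleton_iff_punctured_nhds x |>.2 hx
  obtain ⟨n, hn⟩ := 𝒳.dense.exists_mem_open hx' ⟨x, rfl⟩
  rw [Set.mem_singleton_iff] at hn
  exact ⟨n, hn ▸ hx'⟩

variable {𝒳} {n : ℕ}

/-- A closed set containing an isolated point has that point in its interior, so the constant answer
`α n` is always correct. -/
lemma BCT₂_le_idZero [CompleteSpace X] (hn : IsOpen {𝒳.α n}) : BCT₂ 𝒳 ≤sW idZero := by
  refine SWReducible.of_names_total
    (OracleComputable.of_computable (Computable.const n))
    (OracleComputable.of_computable (Computable.const 0)) fun p A _ hA => ?_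
  refine ⟨⟨0, rfl⟩, trivial, rfl, fun q w _ _ =>
    ⟨𝒳.α n, isName_const_cauchySpace 𝒳 n, fun hmem => ?_⟩⟩
  obtain ⟨i, hi⟩ := Set.mem_iUnion.1 hmem
  have h : 𝒳.α n ∈ interior (A i : Set X) :=
    mem_interior.2 ⟨_, Set.singleton_subset_iff.2 hi, hn, rfl⟩
  rw [hA i] at h
  exact h

lemma BCT₃_le_idNat [CompleteSpace X] (hn : IsOpen {𝒳.α n}) : BCT₃ 𝒳 ≤sW idNat := by
  obtain ⟨ε, hε, hball⟩ := Metric.isOpen_iff.1 hn _ rfl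
  -- At this precision a hit near the isolated point `α n` must be `α n` itself, so a successful
  -- search certifies `α n ∈ A i`.
  obtain ⟨l, hl⟩ := exists_pow_half_mul_lt hε
  have hR : OracleComputable fun p (t : ℕ) => 𝒳.hit p t.unpair.1 t.unpair.2 n l :=
    OracleComputable.hit 𝒳 computable_unpair_fst computable_unpair_snd (Computable.const n)
      (Computable.const l)
  refine SWReducible.of_names OracleComputable.query
    (ComputablePFun.search hR computable_unpair_fst) fun p A hp hA => ?_
  have hex : ∃ t : ℕ, 𝒳.hit p t.unpair.1 t.unpair.2 n l = true := by
    have hmem : 𝒳.α n ∈ ⋃ i, (A i : Set X) := by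
      have hA' : ⋃ i, (A i : Set X) = Set.univ := hA
      rw [hA']
      trivial
    obtain ⟨i, hi⟩ := Set.mem_iUnion.1 hmem
    obtain ⟨m, hm⟩ := exists_hit_of_mem hp (l := l) hi (by rw [dist_self]; positivity)
    exact ⟨Nat.pair i m, by simpa using hm⟩
  refine ⟨_, ⟨hex, rfl⟩, (Nat.find hex).unpair.1, trivial, rfl, ?_⟩
  rintro q i hq rfl
  refine ⟨_, hq, 𝒳.α n, mem_interior.2 ⟨_, Set.singleton_subset_iff.2 ?_, hn, rfl⟩⟩
  obtain ⟨y, hy, hyn⟩ := exists_mem_of_hit hp (Nat.find_spec hex)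
  have hyn' : y = 𝒳.α n := hball (Metric.mem_ball.2 (hyn.trans hl))
  exact hyn' ▸ hy

end Weihrauch

theorem corollary4p5 {X : Type*} [MetricSpace X] [CompleteSpace X] (𝒳 : ComputableMetric X) :
    (PerfectSpace X ↔ ¬ (BCT₃ 𝒳).IsComputable) ∧
    (PerfectSpace X → BCT₃ 𝒳 ≡sW CLNat) ∧
    (¬ PerfectSpace X → BCT₂ 𝒳 ≡sW idZero ∧ BCT₃ 𝒳 ≡sW idNat) := by
  refine ⟨⟨fun _ h => CLNat_not_isComputable ((CLNat_le_BCT₃ 𝒳).isComputable h), fun h => ?_⟩,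
    fun _ => ⟨BCT₃_le_CLNat 𝒳, CLNat_le_BCT₃ 𝒳⟩, fun h => ?_⟩
  · by_contra hX
    obtain ⟨n, hn⟩ := exists_isOpen_singleton 𝒳 hX
    exact h ((BCT₃_le_idNat hn).isComputable (idProblem_isComputable natSpace))
  · obtain ⟨n, hn⟩ := exists_isOpen_singleton 𝒳 h
    exact ⟨⟨BCT₂_le_idZero hn, idZero_le_BCT₂ 𝒳⟩, BCT₃_le_idNat hn, idNat_le_BCT₃ 𝒳⟩
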